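/- Let $d\ge 1$, $\Omega=\{1,\dots,d\}^{\mathbb N}$, with sites numbered from $0$, so $x=(x_0,x_1,\dots)$. Let $\sigma(x)_i=x_{i+1}$ be the left shift, and let $\operatorname{dist}(x,y)=2^{-N}$ with $N=\inf\{i: x_i\ne y_i\}$ ($\operatorname{dist}(x,y)=0$ if $x=y$). Let $\mathscr F$ be the product (equivalently, Borel) $\sigma$-algebra, and let $\sigma^n\mathscr F=\{(\sigma^n)^{-1}(F):F\in\mathscr F\}$. Put $\Lambda_n=\{0,\dots,n-1\}$ and fix $\beta>0$. An interaction is a family $\Phi=\{\Phi_A\}$ of functions $\Phi_A:\Omega\to\mathbb R$ indexed by the finite sets $A\subset\mathbb N$. It is uniformly absolutely summable if each $\Phi_A$ depends only on the coordinates in $A$ and $$\sup_{n}\ \sum_{A\ni n}\ \sup_{x\in\Omega}|\Phi_A(x)|<\infty .$$ Given functions $H_n:\Omega\to\mathbb R$, put, for $F\in\mathscr F$ and $y\in\Omega$, $$K_n(F,y)=\frac1{Z_n^y}\sum_{x:\,\sigma^n(x)=\sigma^n(y)}1_F(x)\,e^{-\beta H_n(x)},\qquad Z_n^y=\sum_{x:\,\sigma^n(x)=\sigma^n(y)}e^{-\beta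 H_n(x)} .$$ The DLR-Gibbs measures of $(H_n)$ at inverse temperature $\beta$ are the Borel probability measures $\mu$ on $\Omega$ such that, for all $F\in\mathscr F$ and all $n$, $\mu(F\mid\sigma^n\mathscr F)(y)=K_n(F,y)$ for $\mu$-almost every $y$. Put $$D=\sup_{n}\ \sup_{x,y\in\Omega,\ \operatorname{dist}(x,y)\le 2^{-n}}|H_n(x)-H_n(y)| .$$ **Theorem.** (i) Let $\Phi$ be a uniformly absolutely summable interaction and $H_n(x)=\sum_{A\cap\Lambda_n\neq\emptyset}\Phi_A(x)$. If $D<\infty$, then there is exactly one DLR-Gibbs measure of $(H_n)$ at inverse temperature $\beta$. (ii) Let $f:\Omega\to\mathbb R$ be continuous and $H_n(x)=f(x)+f(\sigma x)+\dots+f(\sigma^{n-1}x)$. If $D<\infty$, then there is exactly one DLR-Gibbs measure of $(H_n)$ at inverse temperature $\beta$. -/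

import Mathlib

open MeasureTheory
open scoped ENNReal

/-- The symbolic space `{1, …, d}^ℕ`; sites are numbered from `0`. -/
abbrev SymbSpace (d : ℕ) : Type := ℕ → Fin d

namespace SymbSpace

/-- The left shift `σ`. -/
def shift {d : ℕ} (x : SymbSpace d) : SymbSpace d := fun i => x (i + 1)

open Classical in
/-- The metric `d(x, y) = 2^{-N}`, where `N = inf {i : x i ≠ y i}` (and `0` when `x = y`). -/
noncomputable def symbDist {d : ℕ} (x y : SymbSpace d) : ℝ :=
  if x = y then 0 else (2 ^ sInf {i : ℕ | x i ≠ y i})⁻¹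

theorem shift_iterate_apply {d : ℕ} (n : ℕ) (x : SymbSpace d) (i : ℕ) :
    (shift^[n] x) i = x (i + n) := by
  induction n generalizing i with
  | zero => rfl
  | succ n ih =>
    rw [Function.iterate_succ_apply']
    change (shift^[n] x) (i + 1) = _
    rw [ih]
    congr 1
    omega

/-- For every `y`, only finitely many `x` satisfy `σ^n x = σ^n y`. -/
theorem finite_fiber {d : ℕ} (n : ℕ) (y : SymbSpace d) :
    {x : SymbSpace d | shift^[n] x = shift^[n] y}.Finite := by
  refine Set.Finite.of_injOn (f := fun x (j : Fin n) => x j) (t := Set.univ)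
    (fun _ _ => Set.mem_univ _) ?_ Set.finite_univ
  intro x hx z hz hxz
  funext i
  by_cases hi : i < n
  · exact congrFun hxz ⟨i, hi⟩
  · have h := congrFun ((show shift^[n] x = shift^[n] y from hx).trans
      (show shift^[n] z = shift^[n] y from hz).symm) (i - n)
    rw [shift_iterate_apply, shift_iterate_apply, Nat.sub_add_cancel (not_lt.mp hi)] at h
    exact h

/-- The finite set `{x : σ^n x = σ^n y}`. -/
noncomputable def fiber {d : ℕ} (n : ℕ) (y : SymbSpace d) : Finset (SymbSpace d) :=
  (finite_fiber n y).toFinset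

/-- The `σ`-algebra `σ^n 𝓕` of the events `(σ^n)⁻¹(F)`, `F` measurable. -/
@[reducible] def tailSigma (d n : ℕ) : MeasurableSpace (SymbSpace d) :=
  MeasurableSpace.comap (shift^[n]) inferInstance

end SymbSpace

open SymbSpace

/-- An interaction: a family of functions `Φ_A : Ω → ℝ` indexed by the finite sets of sites. -/
abbrev Interaction (d : ℕ) : Type := Finset ℕ → SymbSpace d → ℝ

/-- `‖Φ‖ = sup_n ∑_{A ∋ n} sup_x |Φ_A(x)|`, with values in `[0, ∞]`. -/
noncomputable def Interaction.norm {d : ℕ} (Φ : Interaction d) : ℝ≥0∞ :=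
  ⨆ n : ℕ, ∑' A : {A : Finset ℕ // n ∈ A}, ⨆ x : SymbSpace d, ENNReal.ofReal |Φ A.1 x|

/-- Uniformly absolutely summable interactions. -/
structure Interaction.IsUniformlyAbsolutelySummable {d : ℕ} (Φ : Interaction d) : Prop where
  dependsOn : ∀ A : Finset ℕ, DependsOn (Φ A) (A : Set ℕ)
  norm_lt_top : Φ.norm < ∞

/-- `H_n(x) = ∑_{A ∩ Λ_n ≠ ∅} Φ_A(x)`, where `Λ_n` consists of the first `n` sites.
The series converges absolutely when `Φ` is uniformly absolutely summable. -/
noncomputable def Interaction.hamiltonian {d : ℕ} (Φ : Interaction d) (n : ℕ)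
    (x : SymbSpace d) : ℝ :=
  ∑' A : {A : Finset ℕ // (A ∩ Finset.range n).Nonempty}, Φ A.1 x

/-- `H_n(x) = f(x) + f(σ x) + ⋯ + f(σ^{n-1} x)`. -/
def potentialHamiltonian {d : ℕ} (f : SymbSpace d → ℝ) (n : ℕ) (x : SymbSpace d) : ℝ :=
  ∑ j ∈ Finset.range n, f (shift^[j] x)

/-- `D = sup_n sup_{d(x,y) ≤ 2^{-n}} |H_n(x) - H_n(y)|`, with values in `[0, ∞]`.
(The term `n = 0` vanishes for the Hamiltonians above, as `H_0 = 0`.) -/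
noncomputable def hamiltonianOscillation {d : ℕ} (H : ℕ → SymbSpace d → ℝ) : ℝ≥0∞ :=
  ⨆ (n : ℕ) (x : SymbSpace d) (y : SymbSpace d) (_ : symbDist x y ≤ (2 ^ n)⁻¹),
    ENNReal.ofReal |H n x - H n y|

/-- The partition function `Z_n^y(β)`. -/
noncomputable def partitionFunction {d : ℕ} (β : ℝ) (H : ℕ → SymbSpace d → ℝ) (n : ℕ)
    (y : SymbSpace d) : ℝ :=
  ∑ x ∈ fiber n y, Real.exp (-β * H n x)

/-- The Gibbsian specification
`K_n(F, y) = Z_n^y(β)⁻¹ ∑_{σ^n x = σ^n y} 1_F(x) exp(-β H_n(x))`. -/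
noncomputable def gibbsKernel {d : ℕ} (β : ℝ) (H : ℕ → SymbSpace d → ℝ) (n : ℕ)
    (F : Set (SymbSpace d)) (y : SymbSpace d) : ℝ :=
  (1 / partitionFunction β H n y) *
    ∑ x ∈ fiber n y, F.indicator (fun _ => (1 : ℝ)) x * Real.exp (-β * H n x)

/-- The set of DLR-Gibbs measures: the Borel probability measures `μ` with
`μ(F | σ^n 𝓕)(y) = K_n(F, y)` for `μ`-a.e. `y`, for all measurable `F` and all `n`.
(For `n = 0` the condition holds for every `μ`.) -/
def dlrGibbsMeasures {d : ℕ} (β : ℝ) (H : ℕ → SymbSpace d → ℝ) :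
    Set (ProbabilityMeasure (SymbSpace d)) :=
  {μ | ∀ F : Set (SymbSpace d), MeasurableSet F → ∀ n : ℕ,
    condExp (tailSigma d n) (μ : Measure (SymbSpace d)) (F.indicator fun _ => (1 : ℝ))
      =ᵐ[(μ : Measure (SymbSpace d))] gibbsKernel β H n F}

open Filter Topology
open scoped BoundedContinuousFunction

namespace SymbSpace

variable {d : ℕ}

theorem mem_fiber {n : ℕ} {x y : SymbSpace d} : x ∈ fiber n y ↔ shift^[n] x = shift^[n] y := by
  simp [fiber]

theorem fiber_congr {n : ℕ} {x y : SymbSpace d} (h : shift^[n] x = shift^[n] y) :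
    fiber n x = fiber n y := by
  ext z
  rw [mem_fiber, mem_fiber, h]

theorem shift_iterate_eq_of_le {m n : ℕ} (hmn : m ≤ n) {x y : SymbSpace d}
    (h : shift^[m] x = shift^[m] y) : shift^[n] x = shift^[n] y := by
  obtain ⟨k, rfl⟩ := Nat.exists_eq_add_of_le' hmn
  rw [Function.iterate_add_apply, Function.iterate_add_apply, h]

theorem shift_iterate_eq_iff {n : ℕ} {x y : SymbSpace d} :
    shift^[n] x = shift^[n] y ↔ ∀ i, n ≤ i → x i = y i := by
  constructor
  · intro h i hi
    have := congrFun h (i - n)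
    rwa [shift_iterate_apply, shift_iterate_apply, Nat.sub_add_cancel hi] at this
  · intro h
    funext i
    rw [shift_iterate_apply, shift_iterate_apply]
    exact h _ (Nat.le_add_left _ _)

/-- The sequence that starts with the word `a` and continues with `z`. -/
def join {n : ℕ} (a : Fin n → Fin d) (z : SymbSpace d) : SymbSpace d := fun i =>
  if h : i < n then a ⟨i, h⟩ else z (i - n)

theorem join_apply_lt {n i : ℕ} (a : Fin n → Fin d) (z : SymbSpace d) (h : i < n) :
    join a z i = a ⟨i, h⟩ := by
  simp [join, h]

theorem shift_iterate_join {n : ℕ} (a : Fin n → Fin d) (z : SymbSpace d) :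
    shift^[n] (join a z) = z := by
  funext i
  simp [shift_iterate_apply, join]

theorem join_shift_iterate {n : ℕ} (x : SymbSpace d) :
    join (fun i : Fin n => x i) (shift^[n] x) = x := by
  funext i
  by_cases h : i < n
  · simp [join, h]
  · simp [join, h, shift_iterate_apply, Nat.sub_add_cancel (not_lt.mp h)]

theorem join_injective_left {n : ℕ} (z : SymbSpace d) :
    Function.Injective fun a : Fin n → Fin d => join a z := by
  intro a b h
  funext i
  have := congrFun h i
  simpa [join] using this

theorem sum_fiber {M : Type*} [AddCommMonoid M] (n : ℕ) (y : SymbSpace d) (g : SymbSpace d → M) :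
    ∑ x ∈ fiber n y, g x = ∑ a : Fin n → Fin d, g (join a (shift^[n] y)) := by
  symm
  refine Finset.sum_bij (fun a _ => join a (shift^[n] y)) ?_ ?_ ?_ ?_
  · intro a _
    rw [mem_fiber, shift_iterate_join]
  · intro a _ b _ h
    exact join_injective_left _ h
  · intro x hx
    refine ⟨fun i => x i, Finset.mem_univ _, ?_⟩
    rw [← mem_fiber.1 hx]
    exact join_shift_iterate x
  · intro a _
    rfl

theorem continuous_shift : Continuous (shift : SymbSpace d → SymbSpace d) :=
  continuous_pi fun i => continuous_apply (i + 1)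

theorem continuous_shift_iterate (n : ℕ) : Continuous (shift^[n] : SymbSpace d → SymbSpace d) :=
  continuous_shift.iterate n

theorem continuous_join {n : ℕ} (a : Fin n → Fin d) : Continuous (join a) := by
  refine continuous_pi fun i => ?_
  by_cases h : i < n
  · simpa [join, h] using continuous_const
  · simpa [join, h] using continuous_apply (i - n)

theorem symbDist_le_of_forall_lt {n : ℕ} {x y : SymbSpace d} (h : ∀ i < n, x i = y i) :
    symbDist x y ≤ (2 ^ n)⁻¹ := by
  unfold symbDist
  split_ifs with hxy
  · positivity
  · gcongr
    · norm_num
    · refine le_csInf (Function.ne_iff.1 hxy) fun i hi => ?_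
      by_contra hlt
      exact hi (h i (not_le.1 hlt))

end SymbSpace

/-- The average of `h` over the fibre of `σ^n` through `y`, weighted by `exp (-β H_n)`. -/
noncomputable def gibbsAverage {d : ℕ} (β : ℝ) (H : ℕ → SymbSpace d → ℝ) (n : ℕ)
    (h : SymbSpace d → ℝ) (y : SymbSpace d) : ℝ :=
  (1 / partitionFunction β H n y) * ∑ x ∈ fiber n y, h x * Real.exp (-β * H n x)

/-- The weight that the specification gives to the word `a` in front of `σ^n y`. -/
noncomputable def gibbsWeight {d : ℕ} (β : ℝ) (H : ℕ → SymbSpace d → ℝ) (n : ℕ)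
    (a : Fin n → Fin d) (y : SymbSpace d) : ℝ :=
  Real.exp (-β * H n (join a (shift^[n] y))) / partitionFunction β H n y

section Specification

variable {d : ℕ} (β : ℝ) (H : ℕ → SymbSpace d → ℝ) (n : ℕ)

theorem gibbsKernel_eq_gibbsAverage (F : Set (SymbSpace d)) :
    gibbsKernel β H n F = gibbsAverage β H n (F.indicator fun _ => (1 : ℝ)) := rfl

theorem partitionFunction_pos (y : SymbSpace d) : 0 < partitionFunction β H n y :=
  Finset.sum_pos (fun _ _ => Real.exp_pos _) ⟨y, mem_fiber.2 rfl⟩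

theorem partitionFunction_congr {x y : SymbSpace d} (h : shift^[n] x = shift^[n] y) :
    partitionFunction β H n x = partitionFunction β H n y := by
  rw [partitionFunction, partitionFunction, fiber_congr h]

theorem partitionFunction_eq_sum (y : SymbSpace d) :
    partitionFunction β H n y =
      ∑ a : Fin n → Fin d, Real.exp (-β * H n (join a (shift^[n] y))) :=
  sum_fiber n y _

theorem gibbsWeight_nonneg (a : Fin n → Fin d) (y : SymbSpace d) : 0 ≤ gibbsWeight β H n a y :=
  div_nonneg (Real.exp_pos _).le (partitionFunction_pos β H n y).le

theorem sum_gibbsWeight (y : SymbSpace d) : ∑ a, gibbsWeight β H n a y = 1 := by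
  simp only [gibbsWeight]
  rw [← Finset.sum_div, ← partitionFunction_eq_sum, div_self (partitionFunction_pos β H n y).ne']

theorem gibbsWeight_le_one (a : Fin n → Fin d) (y : SymbSpace d) : gibbsWeight β H n a y ≤ 1 := by
  rw [← sum_gibbsWeight β H n y]
  exact Finset.single_le_sum (fun b _ => gibbsWeight_nonneg β H n b y) (Finset.mem_univ a)

theorem gibbsAverage_eq_sum (h : SymbSpace d → ℝ) (y : SymbSpace d) :
    gibbsAverage β H n h y =
      ∑ a : Fin n → Fin d, gibbsWeight β H n a y * h (join a (shift^[n] y)) := by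
  rw [gibbsAverage, sum_fiber, Finset.mul_sum]
  refine Finset.sum_congr rfl fun a _ => ?_
  rw [gibbsWeight]
  ring

theorem abs_gibbsAverage_le {h : SymbSpace d → ℝ} {C : ℝ} (hC : ∀ x, |h x| ≤ C)
    (y : SymbSpace d) : |gibbsAverage β H n h y| ≤ C := by
  rw [gibbsAverage_eq_sum]
  refine (Finset.abs_sum_le_sum_abs _ _).trans ?_
  calc ∑ a, |gibbsWeight β H n a y * h (join a (shift^[n] y))|
      ≤ ∑ a, gibbsWeight β H n a y * C := by
        refine Finset.sum_le_sum fun a _ => ?_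
        rw [abs_mul, abs_of_nonneg (gibbsWeight_nonneg β H n a y)]
        exact mul_le_mul_of_nonneg_left (hC _) (gibbsWeight_nonneg β H n a y)
    _ = C := by rw [← Finset.sum_mul, sum_gibbsWeight, one_mul]

variable {β H n}

theorem continuous_gibbsWeight (hH : Continuous (H n)) (a : Fin n → Fin d) :
    Continuous (gibbsWeight β H n a) := by
  have key (b : Fin n → Fin d) :
      Continuous fun y => Real.exp (-β * H n (join b (shift^[n] y))) := by
    have := hH.comp ((continuous_join b).comp (continuous_shift_iterate n))
    exact Real.continuous_exp.comp (this.const_mul (-β))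
  refine (key a).div ?_ fun y => (partitionFunction_pos β H n y).ne'
  have : partitionFunction β H n = fun y => ∑ b : Fin n → Fin d,
      Real.exp (-β * H n (join b (shift^[n] y))) := funext (partitionFunction_eq_sum β H n)
  rw [this]
  exact continuous_finsetSum _ fun b _ => key b

theorem continuous_gibbsAverage (hH : Continuous (H n)) {h : SymbSpace d → ℝ}
    (hh : Continuous h) : Continuous (gibbsAverage β H n h) := by
  rw [funext (gibbsAverage_eq_sum β H n h)]
  exact continuous_finsetSum _ fun a _ => (continuous_gibbsWeight hH a).mul
    (hh.comp ((continuous_join a).comp (continuous_shift_iterate n)))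

theorem measurable_gibbsAverage (hH : Continuous (H n)) {h : SymbSpace d → ℝ}
    (hh : Measurable h) : Measurable (gibbsAverage β H n h) := by
  rw [funext (gibbsAverage_eq_sum β H n h)]
  refine Finset.measurable_fun_sum Finset.univ (fun a _ => ?_)
  exact (continuous_gibbsWeight hH a).measurable.mul
    (hh.comp ((continuous_join a).comp (continuous_shift_iterate n)).measurable)

/-- A function that factors through `σ^n` comes out of the average. -/
theorem gibbsAverage_mul_of_congr {g : SymbSpace d → ℝ}
    (hg : ∀ x y, shift^[n] x = shift^[n] y → g x = g y) (h : SymbSpace d → ℝ) (y : SymbSpace d) :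
    gibbsAverage β H n (fun x => g x * h x) y = g y * gibbsAverage β H n h y := by
  have key : ∑ x ∈ fiber n y, g x * h x * Real.exp (-β * H n x) =
      g y * ∑ x ∈ fiber n y, h x * Real.exp (-β * H n x) := by
    rw [Finset.mul_sum]
    refine Finset.sum_congr rfl fun x hx => ?_
    rw [hg x y (mem_fiber.1 hx), mul_assoc]
  rw [gibbsAverage, gibbsAverage, key, mul_left_comm]

/-- Consistency of the specification: `K_n K_m = K_n` for `m ≤ n`. -/
theorem gibbsAverage_gibbsAverage {m : ℕ} (hmn : m ≤ n)
    (hc : ∀ x y, shift^[m] x = shift^[m] y → H n x - H m x = H n y - H m y)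
    (h : SymbSpace d → ℝ) (y : SymbSpace d) :
    gibbsAverage β H n (gibbsAverage β H m h) y = gibbsAverage β H n h y := by
  rw [gibbsAverage, gibbsAverage]
  congr 1
  simp only [gibbsAverage, Finset.mul_sum, Finset.sum_mul]
  rw [Finset.sum_comm' (t' := fiber n y) (s' := fun x => fiber m x)]
  · refine Finset.sum_congr rfl fun x _ => ?_
    have key : ∀ z ∈ fiber m x,
        1 / partitionFunction β H m z * (h x * Real.exp (-β * H m x)) * Real.exp (-β * H n z) =
        1 / partitionFunction β H m x * (h x * Real.exp (-β * H n x)) *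
          Real.exp (-β * H m z) := by
      intro z hz
      have hz' := mem_fiber.1 hz
      rw [partitionFunction_congr β H m hz']
      have e : Real.exp (-β * H m x) * Real.exp (-β * H n z) =
          Real.exp (-β * H n x) * Real.exp (-β * H m z) := by
        rw [← Real.exp_add, ← Real.exp_add]
        congr 1
        linear_combination (-β) * hc z x hz'
      linear_combination (1 / partitionFunction β H m x * h x) * e
    rw [Finset.sum_congr rfl key, ← Finset.mul_sum]
    change _ * partitionFunction β H m x = _
    field_simp [(partitionFunction_pos β H m x).ne']
  · intro x z
    simp only [mem_fiber]
    constructor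
    · rintro ⟨h1, h2⟩
      exact ⟨h2.symm, (shift_iterate_eq_of_le hmn h2).trans h1⟩
    · rintro ⟨h1, h2⟩
      exact ⟨(shift_iterate_eq_of_le hmn h1).trans h2, h1.symm⟩

end Specification

/-- The finite measures that every kernel of the specification leaves invariant. -/
def IsGibbsInvariant {d : ℕ} (β : ℝ) (H : ℕ → SymbSpace d → ℝ) (μ : Measure (SymbSpace d)) :
    Prop :=
  ∀ (n : ℕ) (F : Set (SymbSpace d)), MeasurableSet F → ∫ y, gibbsKernel β H n F y ∂μ = μ.real F

section Invariant

variable {d : ℕ} {β : ℝ} {H : ℕ → SymbSpace d → ℝ}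

theorem measurable_gibbsKernel {n : ℕ} (hH : Continuous (H n)) {F : Set (SymbSpace d)}
    (hF : MeasurableSet F) : Measurable (gibbsKernel β H n F) :=
  measurable_gibbsAverage hH (measurable_const.indicator hF)

theorem integrable_of_measurable_of_bounded {μ : Measure (SymbSpace d)} [IsFiniteMeasure μ]
    {g : SymbSpace d → ℝ} (hg : Measurable g) {C : ℝ} (hC : ∀ x, |g x| ≤ C) : Integrable g μ :=
  Integrable.of_bound hg.aestronglyMeasurable C (Eventually.of_forall hC)

theorem abs_indicator_one_le (F : Set (SymbSpace d)) (x : SymbSpace d) :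
    |F.indicator (fun _ => (1 : ℝ)) x| ≤ 1 := by
  by_cases h : x ∈ F <;> simp [h]

theorem indicator_one_congr {F : Set (SymbSpace d)} {x y : SymbSpace d} (h : x ∈ F ↔ y ∈ F) :
    F.indicator (fun _ => (1 : ℝ)) x = F.indicator (fun _ => (1 : ℝ)) y := by
  by_cases hx : x ∈ F
  · simp [hx, h.1 hx]
  · simp [hx, mt h.2 hx]

theorem integrable_gibbsKernel {μ : Measure (SymbSpace d)} [IsFiniteMeasure μ] {n : ℕ}
    (hH : Continuous (H n)) {F : Set (SymbSpace d)} (hF : MeasurableSet F) :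
    Integrable (gibbsKernel β H n F) μ :=
  integrable_of_measurable_of_bounded (measurable_gibbsKernel hH hF)
    (abs_gibbsAverage_le β H n (abs_indicator_one_le F))

theorem tailSigma_le (n : ℕ) : tailSigma d n ≤ MeasurableSpace.pi :=
  (continuous_shift_iterate n).measurable.comap_le

theorem isGibbsInvariant_of_mem {μ : ProbabilityMeasure (SymbSpace d)}
    (hμ : μ ∈ dlrGibbsMeasures β H) : IsGibbsInvariant β H μ := by
  intro n F hF
  rw [← integral_congr_ae (hμ F hF n), integral_condExp (tailSigma_le n),
    integral_indicator hF, setIntegral_const, smul_eq_mul, mul_one]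

theorem mem_dlrGibbsMeasures (hH : ∀ n, Continuous (H n)) {μ : ProbabilityMeasure (SymbSpace d)}
    (hμ : IsGibbsInvariant β H μ) : μ ∈ dlrGibbsMeasures β H := by
  intro F hF n
  symm
  refine ae_eq_condExp_of_forall_setIntegral_eq (tailSigma_le n)
    ((integrable_const 1).indicator hF)
    (fun s _ _ => (integrable_gibbsKernel (hH n) hF).integrableOn) ?_ ?_
  · intro s hs _
    have hs' : MeasurableSet s := tailSigma_le n s hs
    have hcongr : ∀ x y, shift^[n] x = shift^[n] y →
        s.indicator (fun _ => (1 : ℝ)) x = s.indicator (fun _ => (1 : ℝ)) y := by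
      obtain ⟨t, -, rfl⟩ := hs
      intro x y hxy
      have hiff : x ∈ shift^[n] ⁻¹' t ↔ y ∈ shift^[n] ⁻¹' t := by
        rw [Set.mem_preimage, Set.mem_preimage, hxy]
      exact indicator_one_congr hiff
    have hmul : ∀ g : SymbSpace d → ℝ,
        s.indicator g = fun x => s.indicator (fun _ => (1 : ℝ)) x * g x := by
      intro g
      funext x
      by_cases hx : x ∈ s <;> simp [hx]
    rw [← integral_indicator hs', ← integral_indicator hs']
    have h1 : s.indicator (gibbsKernel β H n F) = gibbsKernel β H n (s ∩ F) := by
      rw [hmul, gibbsKernel_eq_gibbsAverage, gibbsKernel_eq_gibbsAverage]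
      funext y
      rw [← gibbsAverage_mul_of_congr hcongr, ← hmul, Set.indicator_indicator]
    rw [h1, hμ n _ (hs'.inter hF), Set.indicator_indicator, integral_indicator (hs'.inter hF),
      setIntegral_const, smul_eq_mul, mul_one]
  · have hfac : gibbsKernel β H n F = (fun z => ∑ a : Fin n → Fin d,
        Real.exp (-β * H n (join a z)) / (∑ b : Fin n → Fin d, Real.exp (-β * H n (join b z))) *
          F.indicator (fun _ => (1 : ℝ)) (join a z)) ∘ shift^[n] := by
      funext y
      rw [gibbsKernel_eq_gibbsAverage, gibbsAverage_eq_sum]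
      simp only [gibbsWeight, partitionFunction_eq_sum, Function.comp]
    have hjoin (a : Fin n → Fin d) : Measurable fun z => Real.exp (-β * H n (join a z)) :=
      (Real.continuous_exp.comp (((hH n).comp (continuous_join a)).const_mul (-β))).measurable
    rw [hfac]
    refine (Measurable.comp ?_ (comap_measurable _)).stronglyMeasurable.aestronglyMeasurable
    refine Finset.measurable_fun_sum _ fun a _ => ?_
    refine ((hjoin a).div (Finset.measurable_fun_sum _ fun b _ => hjoin b)).mul ?_
    exact (measurable_const.indicator hF).comp (continuous_join a).measurable

end Invariant

section Existence

variable {d : ℕ} (β : ℝ) (H : ℕ → SymbSpace d → ℝ)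

/-- The image of `μ` under the `n`-th kernel of the specification. -/
noncomputable def gibbsPush (n : ℕ) (μ : Measure (SymbSpace d)) : Measure (SymbSpace d) :=
  ∑ a : Fin n → Fin d, (μ.withDensity fun y => ENNReal.ofReal (gibbsWeight β H n a y)).map
    fun y => join a (shift^[n] y)

variable {β H}

theorem isFiniteMeasure_withDensity_gibbsWeight {n : ℕ} (μ : Measure (SymbSpace d))
    [IsFiniteMeasure μ] (a : Fin n → Fin d) :
    IsFiniteMeasure (μ.withDensity fun y => ENNReal.ofReal (gibbsWeight β H n a y)) := by
  refine isFiniteMeasure_withDensity (ne_top_of_le_ne_top (measure_ne_top μ Set.univ) ?_)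
  calc ∫⁻ y, ENNReal.ofReal (gibbsWeight β H n a y) ∂μ ≤ ∫⁻ _, 1 ∂μ :=
        lintegral_mono fun y => ENNReal.ofReal_le_one.2 (gibbsWeight_le_one β H n a y)
    _ = μ Set.univ := by simp

theorem isFiniteMeasure_gibbsPush (n : ℕ) (μ : Measure (SymbSpace d)) [IsFiniteMeasure μ] :
    IsFiniteMeasure (gibbsPush β H n μ) := by
  have := isFiniteMeasure_withDensity_gibbsWeight (β := β) (H := H) (n := n) μ
  unfold gibbsPush
  infer_instance

theorem integral_gibbsPush {n : ℕ} (hH : Continuous (H n)) (μ : Measure (SymbSpace d))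
    [IsFiniteMeasure μ] {h : SymbSpace d → ℝ} (hh : Measurable h) {C : ℝ} (hC : ∀ x, |h x| ≤ C) :
    ∫ y, h y ∂(gibbsPush β H n μ) = ∫ y, gibbsAverage β H n h y ∂μ := by
  have hfin := isFiniteMeasure_withDensity_gibbsWeight (β := β) (H := H) (n := n) μ
  have hj (a : Fin n → Fin d) : Measurable fun y => join a (shift^[n] y) :=
    ((continuous_join a).comp (continuous_shift_iterate n)).measurable
  have hw (a : Fin n → Fin d) : Measurable (gibbsWeight β H n a) :=
    (continuous_gibbsWeight hH a).measurable
  unfold gibbsPush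
  rw [integral_finsetSum_measure fun a _ => integrable_of_measurable_of_bounded hh hC]
  simp only [gibbsAverage_eq_sum]
  rw [integral_finsetSum]
  · refine Finset.sum_congr rfl fun a _ => ?_
    rw [integral_map (hj a).aemeasurable hh.aestronglyMeasurable,
      integral_withDensity_eq_integral_toReal_smul (hw a).ennreal_ofReal
        (Eventually.of_forall fun _ => ENNReal.ofReal_lt_top)]
    simp only [ENNReal.toReal_ofReal (gibbsWeight_nonneg β H n a _), smul_eq_mul]
  · intro a _
    refine integrable_of_measurable_of_bounded (C := C) ((hw a).mul (hh.comp (hj a))) fun y => ?_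
    rw [abs_mul, abs_of_nonneg (gibbsWeight_nonneg β H n a y)]
    exact (mul_le_of_le_one_left (abs_nonneg _) (gibbsWeight_le_one β H n a y)).trans (hC _)

theorem exists_isGibbsInvariant (hd : 1 ≤ d) (hH : ∀ n, Continuous (H n))
    (hc : ∀ m n, m ≤ n → ∀ x y, shift^[m] x = shift^[m] y → H n x - H m x = H n y - H m y) :
    ∃ μ : ProbabilityMeasure (SymbSpace d), IsGibbsInvariant β H μ := by
  let y₀ : SymbSpace d := fun _ => ⟨0, hd⟩
  have hint (n : ℕ) (h : SymbSpace d →ᵇ ℝ) :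
      ∫ y, h y ∂(gibbsPush β H n (Measure.dirac y₀)) = gibbsAverage β H n h y₀ := by
    rw [integral_gibbsPush (hH n) _ h.continuous.measurable fun x => h.norm_coe_le_norm x]
    exact integral_dirac' _ _
      (measurable_gibbsAverage (hH n) h.continuous.measurable).stronglyMeasurable
  have hprob (n : ℕ) : IsProbabilityMeasure (gibbsPush β H n (Measure.dirac y₀)) := by
    have := isFiniteMeasure_gibbsPush (β := β) (H := H) n (Measure.dirac y₀)
    have h1 := hint n 1
    rw [gibbsAverage_eq_sum] at h1
    simp only [BoundedContinuousFunction.coe_one, Pi.one_apply, mul_one, sum_gibbsWeight,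
      integral_const, smul_eq_mul] at h1
    constructor
    rw [← ENNReal.toReal_eq_one_iff]
    exact h1
  let κ (n : ℕ) : ProbabilityMeasure (SymbSpace d) := ⟨_, hprob n⟩
  obtain ⟨μ, -, hμ⟩ := isCompact_univ.ultrafilter_le_nhds ((hyperfilter ℕ).map κ)
    (by simp)
  have hle : (hyperfilter ℕ : Filter ℕ) ≤ atTop := by
    rw [← Nat.cofinite_eq_atTop]
    exact hyperfilter_le_cofinite
  have hlim : Tendsto κ (hyperfilter ℕ) (𝓝 μ) := hμ
  have hlim' := ProbabilityMeasure.tendsto_iff_forall_integral_tendsto.1 hlim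
  refine ⟨μ, fun m F hF => ?_⟩
  have := isFiniteMeasure_gibbsPush (β := β) (H := H) m (μ : Measure (SymbSpace d))
  have heq : gibbsPush β H m (μ : Measure (SymbSpace d)) = μ := by
    refine ext_of_forall_integral_eq_of_IsFiniteMeasure fun h => ?_
    rw [integral_gibbsPush (hH m) _ h.continuous.measurable fun x => h.norm_coe_le_norm x]
    let g : SymbSpace d →ᵇ ℝ := BoundedContinuousFunction.ofNormedAddCommGroup
      (gibbsAverage β H m h) (continuous_gibbsAverage (hH m) h.continuous) ‖h‖
      (abs_gibbsAverage_le β H m fun x => h.norm_coe_le_norm x)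
    refine tendsto_nhds_unique (hlim' g) ((hlim' h).congr' ?_)
    filter_upwards [hle (eventually_ge_atTop m)] with n hn
    change ∫ y, h y ∂(gibbsPush β H n (Measure.dirac y₀)) =
      ∫ y, g y ∂(gibbsPush β H n (Measure.dirac y₀))
    rw [hint, hint]
    exact (gibbsAverage_gibbsAverage hn (hc m n hn) h y₀).symm
  rw [gibbsKernel_eq_gibbsAverage, ← integral_gibbsPush (hH m) _ (measurable_const.indicator hF)
    (abs_indicator_one_le F), heq, integral_indicator hF, setIntegral_const, smul_eq_mul, mul_one]

end Existence

section Hamiltonians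

variable {d : ℕ}

theorem continuous_of_dependsOn_finset {A : Finset ℕ} {g : SymbSpace d → ℝ}
    (hg : DependsOn g (A : Set ℕ)) : Continuous g := by
  rw [continuous_iff_continuousAt]
  intro x
  have hU : ∀ᶠ y in 𝓝 x, ∀ i ∈ A, y i = x i := by
    rw [eventually_all_finset]
    intro i _
    have := (continuous_apply (A := fun _ : ℕ => Fin d) i).continuousAt (x := x)
    exact this.eventually (eventually_of_mem (mem_nhds_discrete.2 rfl : {x i} ∈ 𝓝 (x i))
      fun _ h => h)
  exact tendsto_nhds_of_eventually_eq (hU.mono fun y hy => hg fun i hi => hy i hi)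

/-- `sup_x |Φ_A(x)|`. -/
noncomputable def Interaction.supNorm (Φ : Interaction d) (A : Finset ℕ) : ℝ≥0∞ :=
  ⨆ x : SymbSpace d, ENNReal.ofReal |Φ A x|

theorem Interaction.tsum_supNorm_ne_top {Φ : Interaction d} (hΦ : Φ.norm < ∞) (n : ℕ) :
    ∑' A : {A : Finset ℕ // (A ∩ Finset.range n).Nonempty}, Φ.supNorm A.1 ≠ ∞ := by
  have hsite (i : ℕ) : ∑' A : Finset ℕ, {A : Finset ℕ | i ∈ A}.indicator Φ.supNorm A ≤ Φ.norm := by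
    rw [← tsum_subtype]
    exact le_iSup (fun n : ℕ => ∑' A : {A : Finset ℕ // n ∈ A}, Φ.supNorm A.1) i
  refine ne_top_of_le_ne_top (ENNReal.mul_ne_top (ENNReal.natCast_ne_top n) hΦ.ne) ?_
  calc ∑' A : {A : Finset ℕ // (A ∩ Finset.range n).Nonempty}, Φ.supNorm A.1
      = ∑' A : Finset ℕ, {A : Finset ℕ | (A ∩ Finset.range n).Nonempty}.indicator Φ.supNorm A :=
        tsum_subtype {A : Finset ℕ | (A ∩ Finset.range n).Nonempty} Φ.supNorm
    _ ≤ ∑' A : Finset ℕ, ∑ i ∈ Finset.range n, {A : Finset ℕ | i ∈ A}.indicator Φ.supNorm A := by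
        refine ENNReal.tsum_le_tsum fun A => ?_
        refine Set.indicator_apply_le' (fun hA => ?_) fun _ => zero_le
        obtain ⟨i, hi⟩ := hA
        rw [Finset.mem_inter] at hi
        have hle := Finset.single_le_sum_of_canonicallyOrdered
          (f := fun i => {A : Finset ℕ | i ∈ A}.indicator Φ.supNorm A) hi.2
        rwa [Set.indicator_of_mem (show A ∈ {A : Finset ℕ | i ∈ A} from hi.1)] at hle
    _ = ∑ i ∈ Finset.range n, ∑' A : Finset ℕ, {A : Finset ℕ | i ∈ A}.indicator Φ.supNorm A :=
        Summable.tsum_finsetSum fun _ _ => ENNReal.summable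
    _ ≤ ∑ _i ∈ Finset.range n, Φ.norm := Finset.sum_le_sum fun i _ => hsite i
    _ = n * Φ.norm := by simp

theorem Interaction.abs_le_toReal_supNorm {Φ : Interaction d} (hΦ : Φ.norm < ∞) {n : ℕ}
    (A : {A : Finset ℕ // (A ∩ Finset.range n).Nonempty}) (x : SymbSpace d) :
    |Φ A.1 x| ≤ (Φ.supNorm A.1).toReal := by
  have hfin : Φ.supNorm A.1 ≠ ∞ :=
    ne_top_of_le_ne_top (Φ.tsum_supNorm_ne_top hΦ n) (ENNReal.le_tsum A)
  rw [← ENNReal.ofReal_le_iff_le_toReal hfin]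
  exact le_iSup (fun x => ENNReal.ofReal |Φ A.1 x|) x

theorem Interaction.summable_hamiltonian {Φ : Interaction d} (hΦ : Φ.norm < ∞) (n : ℕ)
    (x : SymbSpace d) :
    Summable fun A : {A : Finset ℕ // (A ∩ Finset.range n).Nonempty} => Φ A.1 x :=
  Summable.of_norm_bounded (ENNReal.summable_toReal (Φ.tsum_supNorm_ne_top hΦ n))
    fun A => Φ.abs_le_toReal_supNorm hΦ A x

theorem Interaction.continuous_hamiltonian {Φ : Interaction d}
    (hΦ : Φ.IsUniformlyAbsolutelySummable) (n : ℕ) : Continuous (Φ.hamiltonian n) :=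
  continuous_tsum (fun A => continuous_of_dependsOn_finset (hΦ.dependsOn A.1))
    (ENNReal.summable_toReal (Φ.tsum_supNorm_ne_top hΦ.norm_lt_top n))
    fun A x => Φ.abs_le_toReal_supNorm hΦ.norm_lt_top A x

theorem Interaction.hamiltonian_sub_congr {Φ : Interaction d}
    (hΦ : Φ.IsUniformlyAbsolutelySummable) (m n : ℕ) (hmn : m ≤ n) (x y : SymbSpace d)
    (hxy : shift^[m] x = shift^[m] y) :
    Φ.hamiltonian n x - Φ.hamiltonian m x = Φ.hamiltonian n y - Φ.hamiltonian m y := by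
  have hsum (k : ℕ) (z : SymbSpace d) : Summable
      ({A : Finset ℕ | (A ∩ Finset.range k).Nonempty}.indicator fun A => Φ A z) :=
    summable_subtype_iff_indicator.1 (Φ.summable_hamiltonian hΦ.norm_lt_top k z)
  have hH (k : ℕ) (z : SymbSpace d) : Φ.hamiltonian k z =
      ∑' A, {A : Finset ℕ | (A ∩ Finset.range k).Nonempty}.indicator (fun A => Φ A z) A :=
    tsum_subtype {A : Finset ℕ | (A ∩ Finset.range k).Nonempty} fun A => Φ A z
  rw [hH, hH, hH, hH, ← (hsum n x).tsum_sub (hsum m x), ← (hsum n y).tsum_sub (hsum m y)]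
  refine tsum_congr fun A => ?_
  by_cases hm : (A ∩ Finset.range m).Nonempty
  · have hn : (A ∩ Finset.range n).Nonempty :=
      hm.mono (Finset.inter_subset_inter_left (Finset.range_mono hmn))
    simp [hm, hn]
  · have hA : Φ A x = Φ A y := by
      refine hΦ.dependsOn A fun i hi => shift_iterate_eq_iff.1 hxy i ?_
      by_contra hlt
      exact hm ⟨i, Finset.mem_inter.2 ⟨hi, Finset.mem_range.2 (not_le.1 hlt)⟩⟩
    simp only [Set.indicator, hA]

theorem continuous_potentialHamiltonian {f : SymbSpace d → ℝ} (hf : Continuous f) (n : ℕ) :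
    Continuous (potentialHamiltonian f n) :=
  continuous_finsetSum _ fun j _ => hf.comp (continuous_shift_iterate j)

theorem potentialHamiltonian_sub_congr (f : SymbSpace d → ℝ) (m n : ℕ) (hmn : m ≤ n)
    (x y : SymbSpace d) (hxy : shift^[m] x = shift^[m] y) :
    potentialHamiltonian f n x - potentialHamiltonian f m x =
      potentialHamiltonian f n y - potentialHamiltonian f m y := by
  unfold potentialHamiltonian
  rw [← Finset.sum_Ico_eq_sub _ hmn, ← Finset.sum_Ico_eq_sub _ hmn]
  refine Finset.sum_congr rfl fun j hj => ?_
  rw [shift_iterate_eq_of_le (Finset.mem_Ico.1 hj).1 hxy]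

end Hamiltonians

section Uniqueness

variable {d : ℕ} {β : ℝ} {H : ℕ → SymbSpace d → ℝ}

theorem abs_sub_le_hamiltonianOscillation (hD : hamiltonianOscillation H < ∞) {n : ℕ}
    {x y : SymbSpace d} (hxy : ∀ i < n, x i = y i) :
    |H n x - H n y| ≤ (hamiltonianOscillation H).toReal := by
  rw [← ENNReal.ofReal_le_iff_le_toReal hD.ne]
  exact le_iSup_of_le n <| le_iSup_of_le x <| le_iSup_of_le y <|
    le_iSup_of_le (symbDist_le_of_forall_lt hxy) le_rfl

theorem sum_fiber_mul_exp_le (hβ : 0 ≤ β) (hD : hamiltonianOscillation H < ∞) {n : ℕ}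
    {h : SymbSpace d → ℝ} (h0 : ∀ x, 0 ≤ h x) (hdep : DependsOn h (Set.Iio n))
    (y z : SymbSpace d) :
    ∑ x ∈ fiber n y, h x * Real.exp (-β * H n x) ≤
      Real.exp (β * (hamiltonianOscillation H).toReal) *
        ∑ x ∈ fiber n z, h x * Real.exp (-β * H n x) := by
  rw [sum_fiber, sum_fiber, Finset.mul_sum]
  refine Finset.sum_le_sum fun a _ => ?_
  have hagree : ∀ i < n, join a (shift^[n] y) i = join a (shift^[n] z) i := fun i hi => by
    rw [join_apply_lt _ _ hi, join_apply_lt _ _ hi]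
  rw [hdep hagree, mul_left_comm, ← Real.exp_add]
  refine mul_le_mul_of_nonneg_left (Real.exp_le_exp.2 ?_) (h0 _)
  have := mul_le_mul_of_nonneg_left
    (neg_le_of_abs_le (abs_sub_le_hamiltonianOscillation hD hagree)) hβ
  linarith

/-- Bounded distortion of the specification on the events in the first `n` coordinates. -/
theorem gibbsKernel_le_mul (hβ : 0 ≤ β) (hD : hamiltonianOscillation H < ∞) {n : ℕ}
    {F : Set (SymbSpace d)} (hF : DependsOn (F.indicator fun _ => (1 : ℝ)) (Set.Iio n))
    (y z : SymbSpace d) :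
    gibbsKernel β H n F y ≤
      Real.exp (2 * β * (hamiltonianOscillation H).toReal) * gibbsKernel β H n F z := by
  set E := Real.exp (β * (hamiltonianOscillation H).toReal) with hE
  have hEE : Real.exp (2 * β * (hamiltonianOscillation H).toReal) = E * E := by
    rw [hE, ← Real.exp_add]
    congr 1
    ring
  have h0 : ∀ x, 0 ≤ F.indicator (fun _ => (1 : ℝ)) x :=
    Set.indicator_nonneg fun _ _ => zero_le_one
  have hnum := sum_fiber_mul_exp_le hβ hD h0 hF y z
  have hden : partitionFunction β H n z ≤ E * partitionFunction β H n y := by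
    simpa only [one_mul, partitionFunction] using
      sum_fiber_mul_exp_le hβ hD (h := fun _ => 1) (fun _ => zero_le_one) (fun _ _ _ => rfl) z y
  have hy := partitionFunction_pos β H n y
  have hz := partitionFunction_pos β H n z
  rw [hEE]
  unfold gibbsKernel
  rw [one_div_mul_eq_div, one_div_mul_eq_div, ← mul_div_assoc, div_le_div_iff₀ hy hz]
  have hS : 0 ≤ ∑ x ∈ fiber n z, F.indicator (fun _ => (1 : ℝ)) x * Real.exp (-β * H n x) :=
    Finset.sum_nonneg fun x _ => mul_nonneg (h0 x) (Real.exp_pos _).le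
  have hE0 : 0 < E := Real.exp_pos _
  calc _ ≤ (E * ∑ x ∈ fiber n z, F.indicator (fun _ => (1 : ℝ)) x * Real.exp (-β * H n x)) *
        (E * partitionFunction β H n y) :=
        mul_le_mul hnum hden hz.le (mul_nonneg hE0.le hS)
    _ = _ := by ring

theorem measureReal_mul_le_of_dependsOn (hβ : 0 ≤ β) (hD : hamiltonianOscillation H < ∞)
    (hH : ∀ n, Continuous (H n)) {μ ν : Measure (SymbSpace d)} [IsFiniteMeasure μ]
    [IsFiniteMeasure ν] (hμ : IsGibbsInvariant β H μ) (hν : IsGibbsInvariant β H ν) {n : ℕ}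
    {F : Set (SymbSpace d)} (hFm : MeasurableSet F)
    (hF : DependsOn (F.indicator fun _ => (1 : ℝ)) (Set.Iio n)) :
    ν.real Set.univ * μ.real F ≤ Real.exp (2 * β * (hamiltonianOscillation H).toReal) *
      μ.real Set.univ * ν.real F := by
  set C := Real.exp (2 * β * (hamiltonianOscillation H).toReal)
  have step (z : SymbSpace d) : μ.real F ≤ μ.real Set.univ * (C * gibbsKernel β H n F z) := by
    rw [← hμ n F hFm]
    calc ∫ y, gibbsKernel β H n F y ∂μ ≤ ∫ _, C * gibbsKernel β H n F z ∂μ :=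
          integral_mono (integrable_gibbsKernel (hH n) hFm) (integrable_const _)
            fun y => gibbsKernel_le_mul hβ hD hF y z
      _ = _ := by rw [integral_const, smul_eq_mul]
  calc ν.real Set.univ * μ.real F = ∫ _, μ.real F ∂ν := by rw [integral_const, smul_eq_mul]
    _ ≤ ∫ z, μ.real Set.univ * (C * gibbsKernel β H n F z) ∂ν :=
        integral_mono (integrable_const _)
          (((integrable_gibbsKernel (hH n) hFm).const_mul C).const_mul _) step
    _ = C * μ.real Set.univ * ν.real F := by
        rw [integral_const_mul, integral_const_mul, hν n F hFm]
        ring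

/-- The largest subset of `U` that is determined by the first `n` coordinates. -/
def cylinderInterior (n : ℕ) (U : Set (SymbSpace d)) : Set (SymbSpace d) :=
  {x | ∀ y : SymbSpace d, (∀ i < n, y i = x i) → y ∈ U}

theorem cylinderInterior_congr {n : ℕ} {U : Set (SymbSpace d)} {x y : SymbSpace d}
    (h : ∀ i < n, x i = y i) : x ∈ cylinderInterior n U ↔ y ∈ cylinderInterior n U :=
  ⟨fun hx z hz => hx z fun i hi => (hz i hi).trans (h i hi).symm,
    fun hy z hz => hy z fun i hi => (hz i hi).trans (h i hi)⟩

theorem dependsOn_indicator_cylinderInterior (n : ℕ) (U : Set (SymbSpace d)) :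
    DependsOn ((cylinderInterior n U).indicator fun _ => (1 : ℝ)) (Set.Iio n) := by
  intro x y h
  exact indicator_one_congr (cylinderInterior_congr h)

theorem isOpen_cylinderInterior (n : ℕ) (U : Set (SymbSpace d)) :
    IsOpen (cylinderInterior n U) := by
  have hdep : DependsOn ((cylinderInterior n U).indicator fun _ => (1 : ℝ))
      (Finset.range n : Set ℕ) := by
    rw [Finset.coe_range]
    exact dependsOn_indicator_cylinderInterior n U
  have hopen := (continuous_of_dependsOn_finset hdep).isOpen_preimage _ (isOpen_Ioi (a := (0 : ℝ)))
  convert! hopen using 1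
  ext x
  by_cases hx : x ∈ cylinderInterior n U <;> simp [hx]

theorem monotone_cylinderInterior (U : Set (SymbSpace d)) :
    Monotone fun n => cylinderInterior n U :=
  fun _ _ hmn _ hx y hy => hx y fun i hi => hy i (hi.trans_le hmn)

theorem iUnion_cylinderInterior {U : Set (SymbSpace d)} (hU : IsOpen U) :
    ⋃ n, cylinderInterior n U = U := by
  refine Set.Subset.antisymm (Set.iUnion_subset fun n x hx => hx x fun _ _ => rfl) fun x hx => ?_
  obtain ⟨I, u, hu, hsub⟩ := isOpen_pi_iff.1 hU x hx
  refine Set.mem_iUnion.2 ⟨I.sup id + 1, fun y hy => hsub fun i hi => ?_⟩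
  rw [hy i (Nat.lt_succ_of_le (Finset.le_sup (f := id) hi))]
  exact (hu i hi).2

theorem measureReal_mul_le (hβ : 0 ≤ β) (hD : hamiltonianOscillation H < ∞)
    (hH : ∀ n, Continuous (H n)) {μ ν : Measure (SymbSpace d)} [IsFiniteMeasure μ]
    [IsFiniteMeasure ν] (hμ : IsGibbsInvariant β H μ) (hν : IsGibbsInvariant β H ν)
    (F : Set (SymbSpace d)) :
    ν.real Set.univ * μ.real F ≤ Real.exp (2 * β * (hamiltonianOscillation H).toReal) *
      μ.real Set.univ * ν.real F := by
  set C := Real.exp (2 * β * (hamiltonianOscillation H).toReal) * μ.real Set.univ with hC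
  have hC0 : 0 ≤ C := mul_nonneg (Real.exp_pos _).le measureReal_nonneg
  have hopen (U : Set (SymbSpace d)) (hU : IsOpen U) :
      ν.real Set.univ * μ.real U ≤ C * ν.real U := by
    have hlim (ρ : Measure (SymbSpace d)) [IsFiniteMeasure ρ] :
        Tendsto (fun n => ρ.real (cylinderInterior n U)) atTop (𝓝 (ρ.real U)) := by
      have := tendsto_measure_iUnion_atTop (μ := ρ) (monotone_cylinderInterior U)
      rw [iUnion_cylinderInterior hU] at this
      exact (ENNReal.tendsto_toReal (measure_ne_top ρ U)).comp this
    exact le_of_tendsto_of_tendsto' ((hlim μ).const_mul _) ((hlim ν).const_mul _) fun n =>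
      measureReal_mul_le_of_dependsOn hβ hD hH hμ hν (isOpen_cylinderInterior n U).measurableSet
        (dependsOn_indicator_cylinderInterior n U)
  have happrox (k : ℕ) : ν.real Set.univ * μ.real F ≤ C * (ν.real F + 1 / ((k : ℝ) + 1)) := by
    have hk : (0 : ℝ) < 1 / ((k : ℝ) + 1) := Nat.one_div_pos_of_nat
    obtain ⟨U, hFU, hU, hlt⟩ := F.exists_isOpen_lt_add (measure_ne_top ν F)
      (ENNReal.ofReal_pos.2 hk).ne'
    have hνU : ν.real U ≤ ν.real F + 1 / ((k : ℝ) + 1) := by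
      have := ENNReal.toReal_mono
        (ENNReal.add_ne_top.2 ⟨measure_ne_top ν F, ENNReal.ofReal_ne_top⟩) hlt.le
      rwa [ENNReal.toReal_add (measure_ne_top ν F) ENNReal.ofReal_ne_top,
        ENNReal.toReal_ofReal hk.le] at this
    calc ν.real Set.univ * μ.real F ≤ ν.real Set.univ * μ.real U :=
          mul_le_mul_of_nonneg_left (measureReal_mono hFU) measureReal_nonneg
      _ ≤ C * ν.real U := hopen U hU
      _ ≤ _ := mul_le_mul_of_nonneg_left hνU hC0
  have hlim := ((tendsto_one_div_add_atTop_nhds_zero_nat (𝕜 := ℝ)).const_add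
    (ν.real F)).const_mul C
  rw [add_zero] at hlim
  exact ge_of_tendsto' hlim happrox

theorem IsGibbsInvariant.smul {μ : Measure (SymbSpace d)} (hμ : IsGibbsInvariant β H μ)
    (c : ℝ≥0∞) : IsGibbsInvariant β H (c • μ) := by
  intro n F hF
  rw [integral_smul_measure, hμ n F hF, measureReal_ennreal_smul_apply, smul_eq_mul]

theorem IsGibbsInvariant.sub (hH : ∀ n, Continuous (H n)) {μ ν : Measure (SymbSpace d)}
    [IsFiniteMeasure μ] [IsFiniteMeasure ν] (hμ : IsGibbsInvariant β H μ)
    (hν : IsGibbsInvariant β H ν) (hle : ν ≤ μ) : IsGibbsInvariant β H (μ - ν) := by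
  intro n F hF
  have hadd := Measure.sub_add_cancel_of_le hle
  have hint := integral_add_measure (μ := μ - ν) (ν := ν)
    (integrable_gibbsKernel (β := β) (hH n) hF) (integrable_gibbsKernel (hH n) hF)
  have hreal := measureReal_add_apply (μ₁ := μ - ν) (μ₂ := ν) (s := F)
  rw [hadd, hμ n F hF, hν n F hF] at hint
  rw [hadd] at hreal
  linarith

theorem IsGibbsInvariant.le (hβ : 0 ≤ β) (hD : hamiltonianOscillation H < ∞)
    (hH : ∀ n, Continuous (H n)) {μ ν : Measure (SymbSpace d)} [IsProbabilityMeasure μ]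
    [IsProbabilityMeasure ν] (hμ : IsGibbsInvariant β H μ) (hν : IsGibbsInvariant β H ν)
    (F : Set (SymbSpace d)) : μ.real F ≤ ν.real F := by
  set C := Real.exp (2 * β * (hamiltonianOscillation H).toReal) with hC
  have hC1 : 1 ≤ C := Real.one_le_exp (mul_nonneg (by positivity) ENNReal.toReal_nonneg)
  let S : Set ℝ := {c | 1 ≤ c ∧ ∀ F, μ.real F ≤ c * ν.real F}
  have hCS : C ∈ S := by
    refine ⟨hC1, fun F => ?_⟩
    simpa using measureReal_mul_le hβ hD hH hμ hν F
  have hbdd : BddBelow S := ⟨1, fun c hc => hc.1⟩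
  have hclosed : IsClosed S := by
    have hS : S = {c | 1 ≤ c} ∩ ⋂ F, {c | μ.real F ≤ c * ν.real F} := by
      ext c
      simp [S]
    rw [hS]
    refine (isClosed_le continuous_const continuous_id).inter (isClosed_iInter fun F => ?_)
    exact isClosed_le continuous_const (continuous_id.mul continuous_const)
  obtain ⟨hc1, hcF⟩ : sInf S ∈ S := hclosed.csInf_mem ⟨C, hCS⟩ hbdd
  set c := sInf S with hc
  rcases hc1.eq_or_lt with h1 | hlt
  · simpa [← h1] using hcF F
  exfalso
  have hc0 : 0 ≤ c := zero_le_one.trans hc1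
  let cν : Measure (SymbSpace d) := ENNReal.ofReal c • ν
  have : IsFiniteMeasure cν := ν.smul_finite ENNReal.ofReal_ne_top
  have hcν (F : Set (SymbSpace d)) : cν.real F = c * ν.real F := by
    rw [measureReal_ennreal_smul_apply, ENNReal.toReal_ofReal hc0]
  have hle : μ ≤ cν := Measure.le_iff'.2 fun F =>
    (ENNReal.toReal_le_toReal (measure_ne_top _ F) (measure_ne_top _ F)).1 ((hcF F).trans
      (hcν F).ge)
  have hη := (hν.smul (ENNReal.ofReal c)).sub hH hμ hle
  have hηF (F : Set (SymbSpace d)) : (cν - μ).real F = c * ν.real F - μ.real F := by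
    have := measureReal_add_apply (μ₁ := cν - μ) (μ₂ := μ) (s := F)
    rw [Measure.sub_add_cancel_of_le hle, hcν] at this
    linarith
  have hpos : 0 < c - 1 + C := by linarith
  have hmem : C * c / (c - 1 + C) ∈ S := by
    refine ⟨?_, fun F => ?_⟩
    · rw [le_div_iff₀ hpos]
      nlinarith [mul_nonneg (sub_nonneg.2 hC1) (sub_nonneg.2 hc1)]
    · have := measureReal_mul_le hβ hD hH hμ hη F
      rw [hηF, hηF, probReal_univ, probReal_univ, ← hC] at this
      rw [div_mul_eq_mul_div, le_div_iff₀ hpos]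
      linarith
  have hcle : c ≤ C * c / (c - 1 + C) := csInf_le hbdd hmem
  rw [le_div_iff₀ hpos] at hcle
  nlinarith [mul_pos (zero_lt_one.trans hlt) (sub_pos.2 hlt)]

theorem dlrGibbsMeasures_encard_eq_one (hd : 1 ≤ d) (hβ : 0 ≤ β) (hH : ∀ n, Continuous (H n))
    (hc : ∀ m n, m ≤ n → ∀ x y, shift^[m] x = shift^[m] y → H n x - H m x = H n y - H m y)
    (hD : hamiltonianOscillation H < ∞) : (dlrGibbsMeasures β H).encard = 1 := by
  obtain ⟨μ, hμ⟩ := exists_isGibbsInvariant (β := β) hd hH hc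
  refine Set.encard_eq_one.2 ⟨μ, Set.eq_singleton_iff_unique_mem.2
    ⟨mem_dlrGibbsMeasures hH hμ, fun ν hν => ?_⟩⟩
  have hν' := isGibbsInvariant_of_mem hν
  have heq : (ν : Measure (SymbSpace d)) = μ := Measure.ext fun F _ =>
    (measureReal_eq_measureReal_iff (measure_ne_top _ F) (measure_ne_top _ F)).1
      ((hν'.le hβ hD hH hμ F).antisymm (hμ.le hβ hD hH hν' F))
  exact Subtype.ext heq

end Uniqueness

theorem mainTheorem2 (d : ℕ) (hd : 1 ≤ d) (β : ℝ) (hβ : 0 < β) :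
    (∀ Φ : Interaction d, Φ.IsUniformlyAbsolutelySummable →
      hamiltonianOscillation Φ.hamiltonian < ∞ →
        (dlrGibbsMeasures β Φ.hamiltonian).encard = 1) ∧
    (∀ f : SymbSpace d → ℝ, Continuous f →
      hamiltonianOscillation (potentialHamiltonian f) < ∞ →
        (dlrGibbsMeasures β (potentialHamiltonian f)).encard = 1) :=
  ⟨fun _ hΦ hD => dlrGibbsMeasures_encard_eq_one hd hβ.le
      (Interaction.continuous_hamiltonian hΦ) (Interaction.hamiltonian_sub_congr hΦ) hD,
    fun f hf hD => dlrGibbsMeasures_encard_eq_one hd hβ.le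
      (continuous_potentialHamiltonian hf) (potentialHamiltonian_sub_congr f) hD⟩
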